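/- **Setting.** All spaces are measurable spaces; $\mathcal GX$ is the space of subprobability measures on $X$, with the coarsest $\sigma$-algebra making all $\nu\mapsto\nu(A)$ measurable. For a relation $\Phi\subseteq X\times Y$, $\gamma\ge 1$ and $\delta\ge 0$, let $\mathcal G^{(\gamma,\delta)}\Phi$ be the set of pairs $(\nu_1,\nu_2)\in\mathcal GX\times\mathcal GY$ such that $\nu_1(A)\le\gamma\,\nu_2(B)+\delta$ for all measurable $A\subseteq X$, $B\subseteq Y$ with $\Phi(A)\subseteq B$, and let $\overline{\mathcal G^{(\gamma,\delta)}}\Phi=\mathcal G^{(\gamma,\delta)}\Phi\cap(\mathcal G^{(\gamma,\delta)}\Phi^{\mathrm{op}})^{\mathrm{op}}$. Commands of the language pWHILE are built from $\mathtt{skip}$, $\mathtt{null}$, sequencing, assignments $x\leftarrow e$, samplings $x\xleftarrow{\$}d(e_1,\dots,e_n)$, conditionals and while loops, over a finite typing context $\Gamma$ with value types $\mathtt{bool}$, $\mathtt{int}$, $\mathtt{real}$, $\mathtt{data}$ interpreted as the discrete spaces $\{\mathtt{true},\mathtt{false}\}$, $\mathbb Z$ and the Borel spaces $\mathbb R$,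 $\mathbb R^N$. Operations are measurable functions, probabilistic operations are measurable functions into $\mathcal G$, a memory is a point of the product space $[\![\Gamma]\!]$, and a command denotes a measurable map $[\![c]\!]\colon[\![\Gamma]\!]\to\mathcal G[\![\Gamma]\!]$ (Kleisli composition for sequencing, the supremum of the finite unfoldings for loops). A judgement $\models c_1\sim_{\gamma,\delta}c_2\colon\Psi\Rightarrow\Phi$ means that $([\![c_1]\!](m_1),[\![c_2]\!](m_2))\in\overline{\mathcal G^{(\gamma,\delta)}}\Phi$ whenever $(m_1,m_2)\in\Psi$; write $\models^{1}$ for the same with $\mathcal G^{(\gamma,\delta)}$ in place of $\overline{\mathcal G^{(\gamma,\delta)}}$. For $\sigma>0$, $\mathtt{Lap}_\sigma(a)$ is the probability measure on $\mathbb R$ with density proportional to $b\mapsto\exp(-|b-a|/\sigma)$. The notation $e\langle k\rangle$ means the value of $e$ in the $k$-th memory. **Algorithm.** Let $\varepsilon>0$, let $t\in\mathbb R$ be a threshold, $Q\in\mathbb Z$ (a code of) a set of $|Q|\in\mathbb N$ queries, and $\mathtt{eval}\colon\mathbb Z\times\mathbb Z\times\mathbb R^N\to\mathbb R$ a measurable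 function such that $\|d-d'\|_1\le 1$ implies $|\mathtt{eval}(Q,i,d)-\mathtt{eval}(Q,i,d')|\le 1$ for all $i\in\mathbb Z$. $\mathtt{AboveT}$ is the command over the context $j,r\colon\mathtt{int}$, $T,S\colon\mathtt{real}$, $d\colon\mathtt{data}$: $$\begin{array}{l} j\leftarrow 1;\ r\leftarrow |Q|+1;\ T\xleftarrow{\$}\mathtt{Lap}_{2/\varepsilon}(t);\\ \mathtt{while}\ j<|Q|\ \mathtt{do}\ \bigl(S\xleftarrow{\$}\mathtt{Lap}_{4/\varepsilon}(\mathtt{eval}(Q,j,d));\ \mathtt{if}\ T\le S\wedge r=|Q|+1\ \mathtt{then}\ r\leftarrow j;\ \ j\leftarrow j+1\bigr).\end{array}$$ **Theorem.** (1) $\mathtt{AboveT}$ is $(\varepsilon,0)$-differentially private: $$\models\mathtt{AboveT}\sim_{\exp(\varepsilon),0}\mathtt{AboveT}\colon\ \|d\langle1\rangle-d\langle2\rangle\|_1\le 1\ \Rightarrow\ r\langle1\rangle=r\langle2\rangle .$$ (2) The following rules are sound, for every finite context $\Gamma$ and every relation $\Psi$ on $[\![\Gamma]\!]$. * [Forall-Eq]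 Let $x\colon\mathtt{int}$ be a variable, $\gamma\ge1$, $\delta_i\ge 0$ and $\sum_{i\in\mathbb Z}\delta_i=\delta<\infty$. If $\models^{1}c_1\sim_{\gamma,\delta_i}c_2\colon\Psi\Rightarrow(x\langle1\rangle=i\Rightarrow x\langle2\rangle=i)$ for all $i\in\mathbb Z$, then $\models^{1}c_1\sim_{\gamma,\delta}c_2\colon\Psi\Rightarrow x\langle1\rangle=x\langle2\rangle$. If $\models c_1\sim_{\gamma,\delta_i}c_2\colon\Psi\Rightarrow(x\langle1\rangle=i\Rightarrow x\langle2\rangle=i)$ and $\models c_2\sim_{\gamma,\delta_i}c_1\colon\Psi^{\mathrm{op}}\Rightarrow(x\langle1\rangle=i\Rightarrow x\langle2\rangle=i)$ for all $i\in\mathbb Z$, then $\models c_1\sim_{\gamma,\delta}c_2\colon\Psi\Rightarrow x\langle1\rangle=x\langle2\rangle$. * [LapGen] Let $x,y$ be variables and $e_1,e_2$ expressions of type $\mathtt{real}$, $\sigma>0$ and $\rho,\rho'\in\mathbb R$. If $|[\![e_1]\!](m_1)+\rho'-[\![e_2]\!](m_2)|\le\rho$ for all $(m_1,m_2)\in\Psi$,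 then $\models x\xleftarrow{\$}\mathtt{Lap}_\sigma(e_1)\sim_{\exp(\rho/\sigma),0}y\xleftarrow{\$}\mathtt{Lap}_\sigma(e_2)\colon\Psi\Rightarrow x\langle1\rangle+\rho'=y\langle2\rangle$. * [LapNull] Let $x,y$ be variables and $e_1,e_2$ expressions of type $\mathtt{real}$ such that $x$ does not occur in $e_1$ and $y$ does not occur in $e_2$, and let $\sigma>0$. Then $\models x\xleftarrow{\$}\mathtt{Lap}_\sigma(e_1)\sim_{1,0}y\xleftarrow{\$}\mathtt{Lap}_\sigma(e_2)\colon\Psi\Rightarrow x\langle1\rangle-y\langle2\rangle=e_1\langle1\rangle-e_2\langle2\rangle$. -/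

import Mathlib

open MeasureTheory ProbabilityTheory
open scoped ENNReal

namespace ApRHL

noncomputable section

/-! ### The sub-Giry monad and stochastic relations -/

/-- The space of subprobability measures on `X`. As a subtype of `Measure X` it carries the coarsest
σ-algebra that makes every evaluation `ν ↦ ν A` (`A` measurable) measurable. -/
abbrev SubGiry (X : Type) [MeasurableSpace X] : Type := {ν : Measure X // ν Set.univ ≤ 1}

/-- Arrows `X → Y` of the Kleisli category of the sub-Giry monad: kernels all of whose measures are
subprobability measures. -/
abbrev SRel (X Y : Type) [MeasurableSpace X] [MeasurableSpace Y] : Type :=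
  {κ : Kernel X Y // ∀ x, κ x Set.univ ≤ 1}

namespace SRel

variable {X Y Z : Type} [MeasurableSpace X] [MeasurableSpace Y] [MeasurableSpace Z]

/-- The measurable function `X → 𝒢 Y` that underlies an arrow of `SRel`. -/
def toFun (f : SRel X Y) : X → SubGiry Y := fun x => ⟨f.1 x, f.2 x⟩

theorem measurable_toFun (f : SRel X Y) : Measurable f.toFun :=
  f.1.measurable.subtype_mk

instance instIsFiniteKernel (f : SRel X Y) : IsFiniteKernel f.1 :=
  ⟨1, ENNReal.one_lt_top, f.2⟩

/-- `η ∘ f` for a measurable function `f`. -/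
def pure (f : X → Y) (hf : Measurable f) : SRel X Y :=
  ⟨Kernel.deterministic f hf, fun _ => prob_le_one⟩

/-- The unit `η`. -/
def unit : SRel X X := pure (fun x => x) measurable_id

/-- The constant null measure. -/
def bot : SRel X Y := ⟨0, fun _ => by simp⟩

/-- Kleisli composition `g♯ ∘ f`. -/
def comp (g : SRel Y Z) (f : SRel X Y) : SRel X Z :=
  ⟨g.1 ∘ₖ f.1, fun x => by
    rw [Kernel.comp_apply' _ _ _ MeasurableSet.univ]
    calc ∫⁻ y, g.1 y Set.univ ∂(f.1 x) ≤ ∫⁻ _, 1 ∂(f.1 x) := lintegral_mono fun y => g.2 y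
      _ ≤ 1 := by simpa using f.2 x⟩

/-- Case distinction along a measurable Boolean. -/
def cond (b : X → Bool) (hb : Measurable b) (f g : SRel X Y) : SRel X Y :=
  ⟨{ toFun := fun x => if b x = true then f.1 x else g.1 x
     measurable' := Measurable.ite (hb (measurableSet_singleton true))
        f.1.measurable g.1.measurable }, fun x => by
    change (if b x = true then f.1 x else g.1 x) Set.univ ≤ 1
    split_ifs
    · exact f.2 x
    · exact g.2 x⟩

theorem cond_apply (b : X → Bool) (hb : Measurable b) (f g : SRel X Y) (x : X) :
    (cond b hb f g).1 x = if b x = true then f.1 x else g.1 x := rfl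

/-- The order of `SRel`: `f ⊑ g` iff `f x B ≤ g x B` for all `x` and all measurable `B`. -/
theorem le_iff (f g : SRel X Y) :
    f ≤ g ↔ ∀ x B, MeasurableSet B → f.1 x B ≤ g.1 x B := by
  change (∀ x, f.1 x ≤ g.1 x) ↔ _
  simp only [Measure.le_iff]

/-- The supremum of an ω-chain at a point: `B ↦ supₙ (fₙ x B)` on measurable sets. -/
def supMeasure (f : ℕ → SRel X Y) (hf : Monotone f) (x : X) : Measure Y :=
  Measure.ofMeasurable (fun B _ => ⨆ n, (f n).1 x B) (by simp) (fun s hs hd => by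
    simp only [measure_iUnion hd hs, ENNReal.tsum_eq_iSup_sum]
    rw [iSup_comm]
    refine iSup_congr fun t => Eq.symm ?_
    exact ENNReal.finsetSum_iSup_of_monotone (f := fun i n => (f n).1 x (s i))
      fun i _ _ h => (le_iff _ _).1 (hf h) x (s i) (hs i))

theorem supMeasure_apply (f : ℕ → SRel X Y) (hf : Monotone f) (x : X) {B : Set Y}
    (hB : MeasurableSet B) : supMeasure f hf x B = ⨆ n, (f n).1 x B :=
  Measure.ofMeasurable_apply B hB

/-- The supremum of an ω-chain. -/
def sup (f : ℕ → SRel X Y) (hf : Monotone f) : SRel X Y :=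
  ⟨{ toFun := supMeasure f hf
     measurable' := by
        refine Measure.measurable_of_measurable_coe _ fun B hB => ?_
        simp only [supMeasure_apply f hf _ hB]
        exact Measurable.iSup fun n => Kernel.measurable_coe _ hB },
   fun x => (supMeasure_apply f hf x MeasurableSet.univ).le.trans (iSup_le fun n => (f n).2 x)⟩

/-- The `n`-th approximation of a loop: `if b then null else skip` for `n = 0`, and
`if b then (c; approximation k) else skip` for `n = k + 1`. -/
def whileApprox (b : X → Bool) (hb : Measurable b) (c : SRel X X) : ℕ → SRel X X
  | 0 => cond b hb bot unit
  | k + 1 => cond b hb (comp (whileApprox b hb c k) c) unit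

theorem cond_le_cond (b : X → Bool) (hb : Measurable b) {f f' : SRel X Y} (g : SRel X Y)
    (h : f ≤ f') : cond b hb f g ≤ cond b hb f' g := by
  rw [le_iff] at h ⊢
  intro x B hB
  simp only [cond_apply]
  split_ifs
  · exact h x B hB
  · exact le_rfl

theorem comp_le_comp {f f' : SRel Y Z} (g : SRel X Y) (h : f ≤ f') : comp f g ≤ comp f' g := by
  rw [le_iff] at h ⊢
  intro x B hB
  simp only [comp, Kernel.comp_apply' _ _ _ hB]
  exact lintegral_mono fun y => h y B hB

theorem whileApprox_mono (b : X → Bool) (hb : Measurable b) (c : SRel X X) :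
    Monotone (whileApprox b hb c) := by
  refine monotone_nat_of_le_succ fun n => ?_
  induction n with
  | zero => exact cond_le_cond b hb _ ((le_iff _ _).2 fun x B _ => by simp [bot])
  | succ k ih => exact cond_le_cond b hb _ (comp_le_comp _ ih)

/-- The loop `while b do c`, as the supremum of its approximations. -/
def loop (b : X → Bool) (hb : Measurable b) (c : SRel X X) : SRel X X :=
  sup (whileApprox b hb c) (whileApprox_mono b hb c)

end SRel

/-! ### Relations between measurable spaces and the graded lifting -/

/-- `(f, g)` is an arrow `Φ → Φ'` of relations between measurable spaces. -/
def IsArrow {X Y X' Y' : Type} [MeasurableSpace X] [MeasurableSpace Y]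
    [MeasurableSpace X'] [MeasurableSpace Y']
    (Φ : X → Y → Prop) (Φ' : X' → Y' → Prop) (f : X → X') (g : Y → Y') : Prop :=
  Measurable f ∧ Measurable g ∧ ∀ x y, Φ x y → Φ' (f x) (g y)

/-- The image `Φ(A)` of a set under a relation. -/
def relImage {X Y : Type} (Φ : X → Y → Prop) (A : Set X) : Set Y := {y | ∃ x ∈ A, Φ x y}

/-- The one-sided lifting `𝒢^(γ,δ) Φ`. -/
def lift {X Y : Type} [MeasurableSpace X] [MeasurableSpace Y] (γ δ : ℝ) (Φ : X → Y → Prop) :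
    SubGiry X → SubGiry Y → Prop :=
  fun ν₁ ν₂ => ∀ (A : Set X) (B : Set Y), MeasurableSet A → MeasurableSet B →
    relImage Φ A ⊆ B → ν₁.1 A ≤ ENNReal.ofReal γ * ν₂.1 B + ENNReal.ofReal δ

/-- The symmetrised lifting: the intersection of `𝒢^(γ,δ) Φ` with the opposite of
`𝒢^(γ,δ)` applied to the opposite of `Φ`. -/
def symLift {X Y : Type} [MeasurableSpace X] [MeasurableSpace Y] (γ δ : ℝ) (Φ : X → Y → Prop) :
    SubGiry X → SubGiry Y → Prop :=
  fun ν₁ ν₂ => lift γ δ Φ ν₁ ν₂ ∧ lift γ δ (fun y x => Φ x y) ν₂ ν₁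

/-! ### The language pWHILE -/

/-- Value types. -/
inductive Ty : Type
  | bool
  | int
  | real
  | data (N : ℕ)

/-- The type of query sets is an alias of `int`. -/
abbrev Ty.queries : Ty := Ty.int

/-- The space interpreting a value type. -/
abbrev Ty.interp : Ty → Type
  | .bool => Bool
  | .int => ℤ
  | .real => ℝ
  | .data N => Fin N → ℝ

/-- `bool` and `int` are discrete; `real` and `data` carry the Borel σ-algebra. -/
instance Ty.instMeasurableSpace : (τ : Ty) → MeasurableSpace τ.interp
  | .bool => (inferInstance : MeasurableSpace Bool)
  | .int => (inferInstance : MeasurableSpace ℤ)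
  | .real => (inferInstance : MeasurableSpace ℝ)
  | .data N => (inferInstance : MeasurableSpace (Fin N → ℝ))

/-- Operations `(τ₁, …, τₙ) → τ`: measurable functions. -/
abbrev Op {n : ℕ} (σ : Fin n → Ty) (τ : Ty) : Type :=
  {p : ((i : Fin n) → (σ i).interp) → τ.interp // Measurable p}

/-- Probabilistic operations `(τ₁, …, τₙ) → τ`: measurable functions to subprobability measures. -/
abbrev POp {n : ℕ} (σ : Fin n → Ty) (τ : Ty) : Type :=
  SRel ((i : Fin n) → (σ i).interp) τ.interp

section Language

variable {V : Type}

/-- Memories of a typing context `Γ`, with the product σ-algebra. -/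
abbrev Mem (Γ : V → Ty) : Type := (x : V) → (Γ x).interp

/-- The variables of type `τ` in the context `Γ`. -/
abbrev Var (Γ : V → Ty) (τ : Ty) : Type := {x : V // Γ x = τ}

/-- Expressions `e ::= x | p(e₁, …, eₙ)`, well typed by construction. -/
inductive Expr (Γ : V → Ty) : Ty → Type
  | var {τ : Ty} (x : Var Γ τ) : Expr Γ τ
  | op {n : ℕ} {σ : Fin n → Ty} {τ : Ty} (p : Op σ τ) (args : (i : Fin n) → Expr Γ (σ i)) :
      Expr Γ τ

/-- Probabilistic expressions `d(e₁, …, eₙ)`. -/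
inductive PExpr (Γ : V → Ty) : Ty → Type
  | op {n : ℕ} {σ : Fin n → Ty} {τ : Ty} (d : POp σ τ) (args : (i : Fin n) → Expr Γ (σ i)) :
      PExpr Γ τ

mutual

/-- Imperatives. -/
inductive Imp (Γ : V → Ty) : Type
  | assign {τ : Ty} (x : Var Γ τ) (e : Expr Γ τ) : Imp Γ
  | sample {τ : Ty} (x : Var Γ τ) (ν : PExpr Γ τ) : Imp Γ
  | ite (b : Expr Γ Ty.bool) (c₁ c₂ : Cmd Γ) : Imp Γ
  | while (b : Expr Γ Ty.bool) (c : Cmd Γ) : Imp Γ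

/-- Commands `c ::= skip | null | i; c`. -/
inductive Cmd (Γ : V → Ty) : Type
  | skip : Cmd Γ
  | null : Cmd Γ
  | seq (i : Imp Γ) (c : Cmd Γ) : Cmd Γ

end

variable {Γ : V → Ty}

/-- An imperative regarded as a command. -/
def Imp.cmd (i : Imp Γ) : Cmd Γ := Cmd.seq i Cmd.skip

/-- The free variables of an expression. -/
def Expr.FV : {τ : Ty} → Expr Γ τ → Set V
  | _, .var x => {x.1}
  | _, .op _ args => ⋃ i, (args i).FV

/-! ### Denotational semantics -/

/-- The projection of a memory to a variable. -/
def Var.get {τ : Ty} (x : Var Γ τ) (m : Mem Γ) : τ.interp := x.2 ▸ m x.1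

theorem Var.measurable_get {τ : Ty} (x : Var Γ τ) : Measurable x.get := by
  obtain ⟨x, rfl⟩ := x
  exact measurable_pi_apply x

/-- Overwriting one variable of a memory. -/
def Var.set [DecidableEq V] {τ : Ty} (x : Var Γ τ) (p : τ.interp × Mem Γ) : Mem Γ :=
  Function.update p.2 x.1 (x.2.symm ▸ p.1)

theorem Var.measurable_set [DecidableEq V] {τ : Ty} (x : Var Γ τ) : Measurable x.set := by
  obtain ⟨x, rfl⟩ := x
  refine measurable_pi_lambda _ fun y => ?_
  by_cases h : y = x
  · subst h
    simpa [Var.set] using measurable_fst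
  · simpa [Var.set, Function.update_of_ne h, Function.comp_def] using
      (measurable_pi_apply (X := fun z => (Γ z).interp) y).comp
        (measurable_snd (α := (Γ x).interp) (β := Mem Γ))

/-- The interpretation of expressions. -/
def Expr.eval : {τ : Ty} → Expr Γ τ → Mem Γ → τ.interp
  | _, .var x, m => x.get m
  | _, .op p args, m => p.1 fun i => (args i).eval m

theorem Expr.measurable_eval {τ : Ty} (e : Expr Γ τ) : Measurable e.eval := by
  induction e with
  | var x => exact x.measurable_get
  | op p args ih => exact p.2.comp (measurable_pi_lambda _ fun i => ih i)

/-- The interpretation of probabilistic expressions. -/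
def PExpr.eval : {τ : Ty} → PExpr Γ τ → SRel (Mem Γ) τ.interp
  | _, .op d args => d.comp
      (SRel.pure (fun m i => (args i).eval m) (measurable_pi_lambda _ fun i => (args i).measurable_eval))

/-- The interpretation of `x ←$ ν`: the value of `ν` is drawn independently of the (Dirac
distributed) current memory, and then stored in `x`. -/
def SRel.draw [DecidableEq V] {τ : Ty} (x : Var Γ τ) (ν : SRel (Mem Γ) τ.interp) :
    SRel (Mem Γ) (Mem Γ) :=
  ⟨(ν.1 ×ₖ Kernel.id).map x.set, fun m => by
    rw [Kernel.map_apply' _ x.measurable_set _ MeasurableSet.univ, Kernel.prod_apply,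
      Kernel.id_apply, Set.preimage_univ, ← Set.univ_prod_univ, Measure.prod_prod,
      measure_univ (μ := Measure.dirac m), mul_one]
    exact ν.2 m⟩

mutual

/-- The interpretation of imperatives. -/
def Imp.interp [DecidableEq V] : Imp Γ → SRel (Mem Γ) (Mem Γ)
  | .assign x e => SRel.pure (fun m => x.set (e.eval m, m))
      (x.measurable_set.comp (e.measurable_eval.prodMk measurable_id))
  | .sample x ν => SRel.draw x ν.eval
  | .ite b c₁ c₂ => SRel.cond b.eval b.measurable_eval c₁.interp c₂.interp
  | .while b c => SRel.loop b.eval b.measurable_eval c.interp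

/-- The interpretation of commands. -/
def Cmd.interp [DecidableEq V] : Cmd Γ → SRel (Mem Γ) (Mem Γ)
  | .skip => SRel.unit
  | .null => SRel.bot
  | .seq i c => c.interp.comp i.interp

end

/-! ### Judgements -/

/-- Validity of the judgement `c₁ ∼_{γ,δ} c₂ : Ψ ⇒ Φ`. -/
def Valid [DecidableEq V] (c₁ c₂ : Cmd Γ) (γ δ : ℝ) (Ψ Φ : Mem Γ → Mem Γ → Prop) : Prop :=
  IsArrow Ψ (symLift γ δ Φ) c₁.interp.toFun c₂.interp.toFun

/-- One-sided validity, with the one-sided lifting in place of its symmetrisation. -/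
def OneSidedValid [DecidableEq V] (c₁ c₂ : Cmd Γ) (γ δ : ℝ) (Ψ Φ : Mem Γ → Mem Γ → Prop) : Prop :=
  IsArrow Ψ (lift γ δ Φ) c₁.interp.toFun c₂.interp.toFun

end Language

/-! ### The Laplacian mechanism -/

/-- The unnormalised density of the Laplacian mechanism with scale `s`, centred at `a`. -/
def lapDensity (s a b : ℝ) : ℝ≥0∞ := ENNReal.ofReal (2 / s * Real.exp (-|b - a| / s))

theorem measurable_lapDensity (s : ℝ) :
    Measurable (Function.uncurry (lapDensity s)) := by
  unfold lapDensity Function.uncurry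
  fun_prop

/-- The Laplacian mechanism `a ↦ f_a`, `f_a(B) = (∫_B f(a,·)) / (∫ f(a,·))`. -/
def lap (s : ℝ) : SRel ℝ ℝ :=
  ⟨{ toFun := fun a => (∫⁻ b, lapDensity s a b)⁻¹ • volume.withDensity (lapDensity s a)
     measurable' := by
        refine Measure.measurable_of_measurable_coe _ fun B hB => ?_
        simp only [Measure.smul_apply, withDensity_apply _ hB, smul_eq_mul]
        exact (Measurable.lintegral_prod_right (measurable_lapDensity s)).inv.mul
          (Measurable.lintegral_prod_right (measurable_lapDensity s)) },
   fun a => by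
     change ((∫⁻ b, lapDensity s a b)⁻¹ • volume.withDensity (lapDensity s a)) Set.univ ≤ 1
     simp only [Measure.smul_apply, withDensity_apply _ MeasurableSet.univ, smul_eq_mul,
       Measure.restrict_univ]
     rw [mul_comm, ← div_eq_mul_inv]
     exact ENNReal.div_self_le_one⟩

/-- The probabilistic operation `Lap_s : real → real`. -/
def lapOp (s : ℝ) : POp ![Ty.real] Ty.real :=
  (lap s).comp (SRel.pure (fun v => v 0) (measurable_pi_apply 0))

section Build

variable {V : Type} {Γ : V → Ty}

/-- The probabilistic expression `Lap_s(e)`. -/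
def PExpr.lap (s : ℝ) (e : Expr Γ Ty.real) : PExpr Γ Ty.real :=
  PExpr.op (lapOp s) (Fin.cons e finZeroElim)

/-- Constants are `0`-ary operations. -/
def Expr.const {τ : Ty} (a : τ.interp) : Expr Γ τ :=
  Expr.op (n := 0) (σ := ![]) ⟨fun _ => a, measurable_const⟩ finZeroElim

/-- Application of a binary operation. -/
def Expr.op₂ {τ₁ τ₂ τ : Ty} (p : τ₁.interp × τ₂.interp → τ.interp) (hp : Measurable p)
    (e₁ : Expr Γ τ₁) (e₂ : Expr Γ τ₂) : Expr Γ τ :=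
  Expr.op (n := 2) (σ := ![τ₁, τ₂])
    ⟨fun v => p (v 0, v 1), hp.comp ((measurable_pi_apply 0).prodMk (measurable_pi_apply 1))⟩
    (Fin.cons e₁ (Fin.cons e₂ finZeroElim))

/-- Application of a ternary operation. -/
def Expr.op₃ {τ₁ τ₂ τ₃ τ : Ty} (p : τ₁.interp × τ₂.interp × τ₃.interp → τ.interp)
    (hp : Measurable p) (e₁ : Expr Γ τ₁) (e₂ : Expr Γ τ₂) (e₃ : Expr Γ τ₃) : Expr Γ τ :=
  Expr.op (n := 3) (σ := ![τ₁, τ₂, τ₃])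
    ⟨fun v => p (v 0, v 1, v 2), hp.comp ((measurable_pi_apply 0).prodMk
      ((measurable_pi_apply 1).prodMk (measurable_pi_apply 2)))⟩
    (Fin.cons e₁ (Fin.cons e₂ (Fin.cons e₃ finZeroElim)))

/-- `e₁ + e₂` on `int`. -/
def Expr.add (e₁ e₂ : Expr Γ Ty.int) : Expr Γ Ty.int :=
  Expr.op₂ (τ₁ := .int) (τ₂ := .int) (τ := .int)
    (fun p : ℤ × ℤ => p.1 + p.2) (measurable_fst.add measurable_snd) e₁ e₂

/-- `e₁ < e₂` on `int`. -/
def Expr.ltInt (e₁ e₂ : Expr Γ Ty.int) : Expr Γ Ty.bool :=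
  Expr.op₂ (τ₁ := .int) (τ₂ := .int) (τ := .bool)
    (fun p : ℤ × ℤ => decide (p.1 < p.2)) (measurable_of_countable _) e₁ e₂

/-- `e₁ = e₂` on `int`. -/
def Expr.eqInt (e₁ e₂ : Expr Γ Ty.int) : Expr Γ Ty.bool :=
  Expr.op₂ (τ₁ := .int) (τ₂ := .int) (τ := .bool)
    (fun p : ℤ × ℤ => decide (p.1 = p.2)) (measurable_of_countable _) e₁ e₂

theorem measurable_decide_le : Measurable fun p : ℝ × ℝ => decide (p.1 ≤ p.2) :=
  measurable_to_bool (by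
    simpa [Set.preimage] using measurableSet_le (measurable_fst (α := ℝ) (β := ℝ)) measurable_snd)

/-- `e₁ ≤ e₂` on `real`. -/
def Expr.leReal (e₁ e₂ : Expr Γ Ty.real) : Expr Γ Ty.bool :=
  Expr.op₂ (τ₁ := .real) (τ₂ := .real) (τ := .bool)
    (fun p : ℝ × ℝ => decide (p.1 ≤ p.2)) measurable_decide_le e₁ e₂

/-- Conjunction. -/
def Expr.and (e₁ e₂ : Expr Γ Ty.bool) : Expr Γ Ty.bool :=
  Expr.op₂ (τ₁ := .bool) (τ₂ := .bool) (τ := .bool)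
    (fun p : Bool × Bool => p.1 && p.2) (measurable_of_countable _) e₁ e₂

end Build

/-! ### The above-threshold algorithm -/

namespace Above

/-- The program variables of the above-threshold algorithm. -/
inductive Name : Type
  | j
  | r
  | T
  | S
  | d
  deriving DecidableEq

/-- Its typing context. -/
abbrev ctx (N : ℕ) : Name → Ty
  | .j => .int
  | .r => .int
  | .T => .real
  | .S => .real
  | .d => .data N

variable {N : ℕ}

def j : Var (ctx N) Ty.int := ⟨.j, rfl⟩
def r : Var (ctx N) Ty.int := ⟨.r, rfl⟩
def T : Var (ctx N) Ty.real := ⟨.T, rfl⟩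
def S : Var (ctx N) Ty.real := ⟨.S, rfl⟩
def d : Var (ctx N) (Ty.data N) := ⟨.d, rfl⟩

/-- The body of the main loop:
`S ←$ Lap_{4/ε}(eval(Q, j, d)); if T ≤ S ∧ r = |Q| + 1 then r ← j; j ← j + 1`,
where `size` is the number `|Q|` of queries. -/
def body (ε : ℝ) (Q : ℤ) (size : ℕ) (evalQ : ℤ × ℤ × (Fin N → ℝ) → ℝ) (hevalQ : Measurable evalQ) :
    Cmd (ctx N) :=
  .seq (.sample S (.lap (4 / ε) (Expr.op₃ (τ₁ := .queries) (τ₂ := .int) (τ₃ := .data N)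
    (τ := .real) evalQ hevalQ (.const (τ := .queries) Q) (.var j) (.var d)))) <|
  .seq (.ite
    ((Expr.leReal (.var T) (.var S)).and
      (Expr.eqInt (.var r) (.add (.const (τ := .int) (size : ℤ)) (.const (τ := .int) (1 : ℤ)))))
    (.seq (.assign r (.var j)) .skip)
    .skip) <|
  .seq (.assign j (.add (.var j) (.const (τ := .int) (1 : ℤ)))) .skip

/-- The above-threshold algorithm:
`j ← 1; r ← |Q| + 1; T ←$ Lap_{2/ε}(t); while j < |Q| do body`. -/
def aboveT (ε t : ℝ) (Q : ℤ) (size : ℕ) (evalQ : ℤ × ℤ × (Fin N → ℝ) → ℝ)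
    (hevalQ : Measurable evalQ) : Cmd (ctx N) :=
  .seq (.assign j (.const (τ := .int) (1 : ℤ))) <|
  .seq (.assign r (.add (.const (τ := .int) (size : ℤ)) (.const (τ := .int) (1 : ℤ)))) <|
  .seq (.sample T (.lap (2 / ε) (.const (τ := .real) t))) <|
  .seq (.while (.ltInt (.var j) (.const (τ := .int) (size : ℤ)))
    (body ε Q size evalQ hevalQ)) .skip

end Above

/-! ### Soundness of the additional proof rules -/

/-- The rule [Forall-Eq] for one-sided validity. -/
def ForallEqOneSidedSound : Prop :=
  ∀ (V : Type) [Finite V] [DecidableEq V] (Γ : V → Ty) (c₁ c₂ : Cmd Γ) (x : Var Γ Ty.int)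
    (γ : ℝ) (δ : ℤ → ℝ) (δ' : ℝ) (Ψ : Mem Γ → Mem Γ → Prop),
    1 ≤ γ → (∀ i, 0 ≤ δ i) → HasSum δ δ' →
    (∀ i : ℤ, OneSidedValid c₁ c₂ γ (δ i) Ψ fun m₁ m₂ => x.get m₁ = i → x.get m₂ = i) →
    OneSidedValid c₁ c₂ γ δ' Ψ fun m₁ m₂ => x.get m₁ = x.get m₂

/-- The rule [Forall-Eq] for (two-sided) validity, with premises for both directions. -/
def ForallEqSound : Prop :=
  ∀ (V : Type) [Finite V] [DecidableEq V] (Γ : V → Ty) (c₁ c₂ : Cmd Γ) (x : Var Γ Ty.int)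
    (γ : ℝ) (δ : ℤ → ℝ) (δ' : ℝ) (Ψ : Mem Γ → Mem Γ → Prop),
    1 ≤ γ → (∀ i, 0 ≤ δ i) → HasSum δ δ' →
    (∀ i : ℤ, Valid c₁ c₂ γ (δ i) Ψ fun m₁ m₂ => x.get m₁ = i → x.get m₂ = i) →
    (∀ i : ℤ, Valid c₂ c₁ γ (δ i) (fun m₂ m₁ => Ψ m₁ m₂)
      fun m₂ m₁ => x.get m₂ = i → x.get m₁ = i) →
    Valid c₁ c₂ γ δ' Ψ fun m₁ m₂ => x.get m₁ = x.get m₂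

/-- The rule [LapGen]. -/
def LapGenSound : Prop :=
  ∀ (V : Type) [Finite V] [DecidableEq V] (Γ : V → Ty) (x y : Var Γ Ty.real)
    (e₁ e₂ : Expr Γ Ty.real) (s ρ ρ' : ℝ) (Ψ : Mem Γ → Mem Γ → Prop),
    0 < s → (∀ m₁ m₂, Ψ m₁ m₂ → |e₁.eval m₁ + ρ' - e₂.eval m₂| ≤ ρ) →
    Valid (Imp.sample x (.lap s e₁)).cmd (Imp.sample y (.lap s e₂)).cmd (Real.exp (ρ / s)) 0 Ψ
      fun m₁ m₂ => x.get m₁ + ρ' = y.get m₂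

/-- The rule [LapNull]. -/
def LapNullSound : Prop :=
  ∀ (V : Type) [Finite V] [DecidableEq V] (Γ : V → Ty) (x y : Var Γ Ty.real)
    (e₁ e₂ : Expr Γ Ty.real) (s : ℝ) (Ψ : Mem Γ → Mem Γ → Prop),
    0 < s → x.1 ∉ e₁.FV → y.1 ∉ e₂.FV →
    Valid (Imp.sample x (.lap s e₁)).cmd (Imp.sample y (.lap s e₂)).cmd 1 0 Ψ
      fun m₁ m₂ => x.get m₁ - y.get m₂ = e₁.eval m₁ - e₂.eval m₂

end

end ApRHL

namespace ApRHL

/-! ### The Laplacian mechanism -/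

-- Everything rests on one estimate, `lintegral_lap_le_of_shift`: two Laplace draws of scale `s` can
-- be compared along `b ↦ b + c` at the price `exp (ρ / s)`, where `ρ` bounds the distance of the
-- centres after the shift. Translation invariance makes the normalising constant independent of the
-- centre, and the triangle inequality bounds the ratio of the densities. [LapGen] is this with `c =
-- ρ'`; [LapNull] takes `c` to be the difference of the centres, so that the price is 1.
--
-- [Forall-Eq] holds because equality of integer values is tested on unions of countably many fibres
-- `x = i`; the bounds on the fibres add up, and so do the errors `δ i` (`lift_eq_of_forall`).
--
-- For the above-threshold algorithm it therefore suffices to bound the probability of each outcome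
-- `r = i` separately. Compare the threshold `T` of the first run with `T + 1` in the second, at
-- price `exp (ε / 2)`. In a round `j ≠ i` use the same noise for both samples, for free: they
-- differ by at most 1, so if the first run stays below its threshold, so does the second; if it
-- does not, then `r = j` for good and the outcome `i` has probability 0 in the first run. In round
-- `i` raise the sample by 1 as well: the shifted centres are within 2, which at scale `4 / ε` costs
-- `exp (ε / 2)`, and success in the first run forces success in the second. No later round matters.
-- This round occurs at most once, so the total price is `exp ε`, however many queries there are.
-- The argument is an induction on the finite unfoldings (`approx_le_of_thr_add_one`) and passes to
-- their supremum.

theorem lap_apply (s a : ℝ) :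
    (lap s).1 a = (∫⁻ b, lapDensity s a b)⁻¹ • volume.withDensity (lapDensity s a) := rfl

theorem measurable_lapDensity_right (s a : ℝ) : Measurable (lapDensity s a) :=
  (measurable_lapDensity s).comp measurable_prodMk_left

theorem lapDensity_add_right (s a b c : ℝ) : lapDensity s (a + c) (b + c) = lapDensity s a b := by
  simp [lapDensity]

theorem lintegral_lapDensity_eq (s a a' : ℝ) :
    ∫⁻ b, lapDensity s a b = ∫⁻ b, lapDensity s a' b := by
  rw [← lintegral_add_right_eq_self (fun b => lapDensity s a' b) (a' - a)]
  refine lintegral_congr fun b => ?_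
  rw [← lapDensity_add_right s a b (a' - a)]
  simp

theorem integrable_exp_neg_abs_div {s : ℝ} (hs : 0 < s) :
    Integrable fun b : ℝ => Real.exp (-|b| / s) := by
  rw [← integrableOn_univ, ← Set.Iic_union_Ioi (a := (0 : ℝ))]
  refine IntegrableOn.union ?_ ?_
  · refine (integrableOn_exp_mul_Iic (inv_pos.2 hs) 0).congr_fun (fun b hb => ?_) measurableSet_Iic
    simp [abs_of_nonpos (Set.mem_Iic.1 hb), div_eq_inv_mul]
  · refine (integrableOn_exp_mul_Ioi (neg_lt_zero.2 (inv_pos.2 hs)) 0).congr_fun (fun b hb => ?_)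
      measurableSet_Ioi
    simp [abs_of_pos (Set.mem_Ioi.1 hb), div_eq_inv_mul]

theorem lintegral_lapDensity_ne_top {s : ℝ} (hs : 0 < s) (a : ℝ) :
    ∫⁻ b, lapDensity s a b ≠ ∞ := by
  rw [lintegral_lapDensity_eq s a 0]
  have h := ((integrable_exp_neg_abs_div hs).const_mul (2 / s)).lintegral_lt_top
  simpa [lapDensity] using h.ne

theorem lintegral_lapDensity_ne_zero {s : ℝ} (hs : 0 < s) (a : ℝ) :
    ∫⁻ b, lapDensity s a b ≠ 0 := by
  rw [Ne, lintegral_eq_zero_iff (measurable_lapDensity_right s a)]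
  intro h
  have h' : ∀ᵐ _ : ℝ, False := by
    filter_upwards [h] with b hb
    have : 0 < lapDensity s a b := ENNReal.ofReal_pos.2 (by positivity)
    exact this.ne' hb
  simp [Measure.measure_univ_eq_zero.symm] at h'

/-- Needed where a draw that no longer influences the outcome must not lose mass
(`approx_of_decided`). The comparisons of two Laplacians only use that the normalising constants
agree. -/
theorem isProbabilityMeasure_lap {s : ℝ} (hs : 0 < s) (a : ℝ) :
    IsProbabilityMeasure ((lap s).1 a) := by
  constructor
  rw [lap_apply, Measure.smul_apply, withDensity_apply _ MeasurableSet.univ, Measure.restrict_univ,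
    smul_eq_mul]
  exact ENNReal.inv_mul_cancel (lintegral_lapDensity_ne_zero hs a)
    (lintegral_lapDensity_ne_top hs a)

theorem lintegral_lap (s a : ℝ) {F : ℝ → ℝ≥0∞} (hF : Measurable F) :
    ∫⁻ b, F b ∂(lap s).1 a = (∫⁻ b, lapDensity s a b)⁻¹ * ∫⁻ b, lapDensity s a b * F b := by
  rw [lap_apply, lintegral_smul_measure,
    lintegral_withDensity_eq_lintegral_mul _ (measurable_lapDensity_right s a) hF]
  rfl

theorem lintegral_lap_add_right (s a c : ℝ) {F : ℝ → ℝ≥0∞} (hF : Measurable F) :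
    ∫⁻ b, F (b + c) ∂(lap s).1 a = ∫⁻ b, F b ∂(lap s).1 (a + c) := by
  rw [lintegral_lap s a (F := fun b => F (b + c)) (by fun_prop), lintegral_lap s _ hF,
    lintegral_lapDensity_eq s a (a + c),
    ← lintegral_add_right_eq_self (fun b => lapDensity s (a + c) b * F b) c]
  simp [lapDensity_add_right]

theorem lapDensity_le {s : ℝ} (hs : 0 < s) {a a' ρ : ℝ} (h : |a - a'| ≤ ρ) (b : ℝ) :
    lapDensity s a b ≤ ENNReal.ofReal (Real.exp (ρ / s)) * lapDensity s a' b := by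
  rw [lapDensity, lapDensity, ← ENNReal.ofReal_mul (Real.exp_pos _).le, mul_left_comm,
    ← Real.exp_add, ← add_div]
  gcongr
  -- The exponents compare by the triangle inequality through `a`.
  have := abs_sub_le b a a'
  linarith

theorem lintegral_lap_le {s : ℝ} (hs : 0 < s) {a a' ρ : ℝ} (h : |a - a'| ≤ ρ)
    {F : ℝ → ℝ≥0∞} (hF : Measurable F) :
    ∫⁻ b, F b ∂(lap s).1 a ≤ ENNReal.ofReal (Real.exp (ρ / s)) * ∫⁻ b, F b ∂(lap s).1 a' := by
  rw [lintegral_lap s a hF, lintegral_lap s a' hF, lintegral_lapDensity_eq s a a', mul_left_comm,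
    ← lintegral_const_mul (f := fun b => lapDensity s a' b * F b) _
      ((measurable_lapDensity_right s a').mul hF)]
  refine mul_le_mul' le_rfl (lintegral_mono fun b => ?_)
  rw [← mul_assoc]
  exact mul_le_mul' (lapDensity_le hs h b) le_rfl

/-- Comparison of two Laplacian expectations along the coupling `b ↦ b + c`. -/
theorem lintegral_lap_le_of_shift {s : ℝ} (hs : 0 < s) {a a' c ρ : ℝ} (h : |a + c - a'| ≤ ρ)
    {F G : ℝ → ℝ≥0∞} (hG : Measurable G) {C : ℝ≥0∞} (hFG : ∀ b, F b ≤ C * G (b + c)) :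
    ∫⁻ b, F b ∂(lap s).1 a ≤ C * (ENNReal.ofReal (Real.exp (ρ / s)) * ∫⁻ b, G b ∂(lap s).1 a') :=
  calc ∫⁻ b, F b ∂(lap s).1 a ≤ ∫⁻ b, C * G (b + c) ∂(lap s).1 a := lintegral_mono hFG
    _ = C * ∫⁻ b, G b ∂(lap s).1 (a + c) := by
      rw [lintegral_const_mul (f := fun b => G (b + c)) _ (by fun_prop),
        lintegral_lap_add_right s a c hG]
    _ ≤ _ := by gcongr; exact lintegral_lap_le hs h hG

theorem lap_apply_le_of_shift {s : ℝ} (hs : 0 < s) {a a' c ρ : ℝ} (h : |a + c - a'| ≤ ρ)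
    {A B : Set ℝ} (hA : MeasurableSet A) (hB : MeasurableSet B) (hAB : ∀ b ∈ A, b + c ∈ B) :
    (lap s).1 a A ≤ ENNReal.ofReal (Real.exp (ρ / s)) * (lap s).1 a' B := by
  have := lintegral_lap_le_of_shift hs h (F := A.indicator 1) (G := B.indicator 1)
    (measurable_one.indicator hB) (C := 1) fun b => by
      by_cases hb : b ∈ A
      · simp [hb, hAB b hb]
      · simp [hb]
  rwa [lintegral_indicator_one hA, lintegral_indicator_one hB, one_mul] at this

/-! ### Semantics of samplings and sequencing -/

theorem SRel.pure_apply {X Y : Type} [MeasurableSpace X] [MeasurableSpace Y] (f : X → Y)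
    (hf : Measurable f) (x : X) : (SRel.pure f hf).1 x = Measure.dirac (f x) :=
  Kernel.deterministic_apply hf x

theorem SRel.comp_apply {X Y Z : Type} [MeasurableSpace X] [MeasurableSpace Y] [MeasurableSpace Z]
    (g : SRel Y Z) (f : SRel X Y) (x : X) : (g.comp f).1 x = (f.1 x).bind g.1 :=
  Kernel.comp_apply _ _ _

theorem SRel.comp_apply_of_dirac {X Y Z : Type} [MeasurableSpace X] [MeasurableSpace Y]
    [MeasurableSpace Z] (g : SRel Y Z) (f : SRel X Y) {x : X} {y : Y}
    (h : f.1 x = Measure.dirac y) : (g.comp f).1 x = g.1 y := by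
  rw [comp_apply, h, Measure.dirac_bind g.1.measurable]

theorem SRel.unit_comp {X Y : Type} [MeasurableSpace X] [MeasurableSpace Y] (f : SRel X Y) :
    SRel.unit.comp f = f := by
  refine Subtype.ext ?_
  exact Kernel.id_comp f.1

section Language

variable {V : Type} {Γ : V → Ty}

theorem PExpr.eval_lap (s : ℝ) (e : Expr Γ Ty.real) (m : Mem Γ) :
    (PExpr.lap s e).eval.1 m = (ApRHL.lap s).1 (e.eval m) := by
  refine (SRel.comp_apply_of_dirac _ _ (SRel.pure_apply _ _ m)).trans ?_
  exact SRel.comp_apply_of_dirac _ _ (SRel.pure_apply _ _ _)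

theorem Var.get_set_self [DecidableEq V] {τ : Ty} (x : Var Γ τ) (v : τ.interp) (m : Mem Γ) :
    x.get (x.set (v, m)) = v := by
  obtain ⟨x, rfl⟩ := x
  simp [Var.get, Var.set]

theorem Expr.eval_congr {τ : Ty} (e : Expr Γ τ) {m m' : Mem Γ} (h : ∀ x ∈ e.FV, m x = m' x) :
    e.eval m = e.eval m' := by
  induction e with
  | var x =>
    have := h x.1 rfl
    simp only [Expr.eval, Var.get, this]
  | op p args ih =>
    simp only [Expr.eval]
    refine congrArg p.1 (funext fun i => ?_)
    exact ih i fun x hx => h x (Set.mem_iUnion.2 ⟨i, hx⟩)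

theorem Expr.eval_set_of_notMem [DecidableEq V] {τ τ' : Ty} (e : Expr Γ τ) (x : Var Γ τ')
    (hx : x.1 ∉ e.FV) (v : τ'.interp) (m : Mem Γ) : e.eval (x.set (v, m)) = e.eval m :=
  e.eval_congr fun y hy => by
    have : y ≠ x.1 := fun h => hx (h ▸ hy)
    simp [Var.set, this]

theorem Var.measurable_set_left [DecidableEq V] {τ : Ty} (x : Var Γ τ) (m : Mem Γ) :
    Measurable fun v => x.set (v, m) :=
  x.measurable_set.comp measurable_prodMk_right

theorem SRel.draw_apply [DecidableEq V] {τ : Ty} (x : Var Γ τ) (ν : SRel (Mem Γ) τ.interp)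
    (m : Mem Γ) : (SRel.draw x ν).1 m = (ν.1 m).map fun v => x.set (v, m) := by
  change ((ν.1 ×ₖ Kernel.id).map x.set) m = _
  rw [Kernel.map_apply _ x.measurable_set, Kernel.prod_apply, Kernel.id_apply,
    Measure.prod_dirac, Measure.map_map x.measurable_set measurable_prodMk_right]
  rfl

theorem Imp.interp_cmd [DecidableEq V] (i : Imp Γ) : i.cmd.interp = i.interp := by
  rw [Imp.cmd, Cmd.interp, Cmd.interp]
  exact SRel.unit_comp _

theorem Imp.interp_sample_lap [DecidableEq V] (x : Var Γ Ty.real) (s : ℝ) (e : Expr Γ Ty.real)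
    (m : Mem Γ) : (Imp.sample x (.lap s e)).interp.1 m =
      ((ApRHL.lap s).1 (e.eval m)).map fun v => x.set (v, m) := by
  rw [Imp.interp, SRel.draw_apply, PExpr.eval_lap]

/-! ### Soundness of the rules -/

/-- The image of `A` under the relation `f a = g b` is the `g`-preimage of `f '' A`, so `A` may be
enlarged to the `f`-preimage of the same set of integers. Both preimages split into countably many
fibres, over which the hypotheses are summed. -/
theorem lift_eq_of_forall {γ δ' : ℝ} {δ : ℤ → ℝ} {X Y : Type} [MeasurableSpace X]
    [MeasurableSpace Y] {f : X → ℤ} {g : Y → ℤ} (hf : Measurable f) (hg : Measurable g)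
    (hδ : ∀ i, 0 ≤ δ i) (hsum : HasSum δ δ') {ν₁ : SubGiry X} {ν₂ : SubGiry Y}
    (h : ∀ i, ν₁.1 (f ⁻¹' {i}) ≤
      ENNReal.ofReal γ * ν₂.1 (g ⁻¹' {i}) + ENNReal.ofReal (δ i)) :
    lift γ δ' (fun a b => f a = g b) ν₁ ν₂ := by
  intro A B hA hB hAB
  have hsub : g ⁻¹' (f '' A) ⊆ B := by
    rintro b ⟨a, ha, hab⟩
    exact hAB ⟨a, ha, hab⟩
  have hpre : ∀ {Z : Type} [MeasurableSpace Z] (ν : Measure Z) {k : Z → ℤ}, Measurable k →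
      ∀ I : Set ℤ, ν (k ⁻¹' I) = ∑' i : I, ν (k ⁻¹' {(i : ℤ)}) := by
    intro Z _ ν k hk I
    rw [← measure_iUnion]
    · congr 1
      ext z
      simp
    · intro i j hij
      exact Disjoint.preimage _ (by simpa [Subtype.ext_iff] using hij)
    · exact fun i => hk (measurableSet_singleton _)
  calc ν₁.1 A ≤ ν₁.1 (f ⁻¹' (f '' A)) := measure_mono (Set.subset_preimage_image f A)
    _ = ∑' i : f '' A, ν₁.1 (f ⁻¹' {(i : ℤ)}) := hpre _ hf _
    _ ≤ ∑' i : f '' A, (ENNReal.ofReal γ * ν₂.1 (g ⁻¹' {(i : ℤ)}) + ENNReal.ofReal (δ i)) :=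
      ENNReal.tsum_le_tsum fun i => h i
    _ = ENNReal.ofReal γ * ν₂.1 (g ⁻¹' (f '' A)) + ∑' i : f '' A, ENNReal.ofReal (δ i) := by
      rw [ENNReal.tsum_add, ENNReal.tsum_mul_left, hpre _ hg]
    _ ≤ ENNReal.ofReal γ * ν₂.1 B + ∑' i, ENNReal.ofReal (δ i) := by
      gcongr
      exact ENNReal.tsum_comp_le_tsum_of_injective Subtype.val_injective
        (fun i => ENNReal.ofReal (δ i))
    _ = _ := by rw [← ENNReal.ofReal_tsum_of_nonneg hδ hsum.summable, hsum.tsum_eq]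

theorem lift_apply_preimage_singleton {γ δ : ℝ} {X Y : Type} [MeasurableSpace X]
    [MeasurableSpace Y] {f : X → ℤ} {g : Y → ℤ} (hf : Measurable f) (hg : Measurable g) {i : ℤ}
    {ν₁ : SubGiry X} {ν₂ : SubGiry Y} (h : lift γ δ (fun a b => f a = i → g b = i) ν₁ ν₂) :
    ν₁.1 (f ⁻¹' {i}) ≤ ENNReal.ofReal γ * ν₂.1 (g ⁻¹' {i}) + ENNReal.ofReal δ := by
  refine h _ _ (hf (measurableSet_singleton i)) (hg (measurableSet_singleton i)) ?_
  rintro b ⟨a, ha, hab⟩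
  exact hab ha

theorem forallEqOneSidedSound : ForallEqOneSidedSound := by
  intro V _ _ Γ c₁ c₂ x γ δ δ' Ψ _ hδ hsum h
  refine ⟨c₁.interp.measurable_toFun, c₂.interp.measurable_toFun, fun m₁ m₂ hm => ?_⟩
  exact lift_eq_of_forall x.measurable_get x.measurable_get hδ hsum fun i =>
    lift_apply_preimage_singleton x.measurable_get x.measurable_get ((h i).2.2 m₁ m₂ hm)

theorem lift_congr_rel {X Y : Type} [MeasurableSpace X] [MeasurableSpace Y] {γ δ : ℝ}
    {Φ Φ' : X → Y → Prop} (h : ∀ x y, Φ x y ↔ Φ' x y) {ν₁ : SubGiry X} {ν₂ : SubGiry Y} :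
    lift γ δ Φ ν₁ ν₂ ↔ lift γ δ Φ' ν₁ ν₂ := by
  rw [show Φ = Φ' from funext₂ fun x y => propext (h x y)]

/-- Only the forward half of each premise is used. The opposite half of the first family bounds the
events `x ≠ i`, not `x = i`; the second family supplies the missing reverse bounds. -/
theorem forallEqSound : ForallEqSound := by
  intro V _ _ Γ c₁ c₂ x γ δ δ' Ψ _ hδ hsum h h'
  refine ⟨c₁.interp.measurable_toFun, c₂.interp.measurable_toFun, fun m₁ m₂ hm => ⟨?_, ?_⟩⟩
  · exact lift_eq_of_forall x.measurable_get x.measurable_get hδ hsum fun i =>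
      lift_apply_preimage_singleton x.measurable_get x.measurable_get ((h i).2.2 m₁ m₂ hm).1
  · refine (lift_congr_rel fun _ _ => eq_comm).1 ?_
    exact lift_eq_of_forall x.measurable_get x.measurable_get hδ hsum fun i =>
      lift_apply_preimage_singleton x.measurable_get x.measurable_get ((h' i).2.2 m₂ m₁ hm).1

/-- By `hΦ` the shift `v ↦ v + c` sends draws that land in `A` to draws that land in `B`, so the
comparison of Laplacians along this shift applies. -/
theorem lift_sample_lap [DecidableEq V] (x y : Var Γ Ty.real) (e₁ e₂ : Expr Γ Ty.real)
    {s ρ c : ℝ} (hs : 0 < s) {m₁ m₂ : Mem Γ} (h : |e₁.eval m₁ + c - e₂.eval m₂| ≤ ρ)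
    {Φ : Mem Γ → Mem Γ → Prop} (hΦ : ∀ v : ℝ, Φ (x.set (v, m₁)) (y.set (v + c, m₂))) :
    lift (Real.exp (ρ / s)) 0 Φ ((Imp.sample x (.lap s e₁)).cmd.interp.toFun m₁)
      ((Imp.sample y (.lap s e₂)).cmd.interp.toFun m₂) := by
  intro A B hA hB hAB
  simp only [SRel.toFun, Imp.interp_cmd, Imp.interp_sample_lap, ENNReal.ofReal_zero, add_zero]
  rw [Measure.map_apply (x.measurable_set_left m₁) hA,
    Measure.map_apply (y.measurable_set_left m₂) hB]
  exact lap_apply_le_of_shift hs h (x.measurable_set_left m₁ hA) (y.measurable_set_left m₂ hB)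
    fun v hv => hAB ⟨_, hv, hΦ v⟩

theorem symLift_sample_lap [DecidableEq V] (x y : Var Γ Ty.real) (e₁ e₂ : Expr Γ Ty.real)
    {s ρ c : ℝ} (hs : 0 < s) {m₁ m₂ : Mem Γ} (h : |e₁.eval m₁ + c - e₂.eval m₂| ≤ ρ)
    {Φ : Mem Γ → Mem Γ → Prop} (hΦ : ∀ v : ℝ, Φ (x.set (v, m₁)) (y.set (v + c, m₂))) :
    symLift (Real.exp (ρ / s)) 0 Φ ((Imp.sample x (.lap s e₁)).cmd.interp.toFun m₁)
      ((Imp.sample y (.lap s e₂)).cmd.interp.toFun m₂) := by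
  -- The opposite direction uses the inverse shift `-c`; the distance of the centres, hence the
  -- price, is unchanged.
  refine ⟨lift_sample_lap x y e₁ e₂ hs h hΦ, lift_sample_lap y x e₂ e₁ (c := -c) hs ?_ fun v => ?_⟩
  · rw [abs_sub_comm] at h
    convert h using 2
    ring
  · simpa using hΦ (v + -c)

theorem lapGenSound : LapGenSound := by
  intro V _ _ Γ x y e₁ e₂ s ρ ρ' Ψ hs h
  refine ⟨SRel.measurable_toFun _, SRel.measurable_toFun _, fun m₁ m₂ hm => ?_⟩
  exact symLift_sample_lap x y e₁ e₂ hs (h m₁ m₂ hm) fun v => by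
    rw [Var.get_set_self x v m₁, Var.get_set_self y (v + ρ') m₂]

theorem lapNullSound : LapNullSound := by
  intro V _ _ Γ x y e₁ e₂ s Ψ hs hx hy
  refine ⟨SRel.measurable_toFun _, SRel.measurable_toFun _, fun m₁ m₂ _ => ?_⟩
  rw [show (1 : ℝ) = Real.exp (0 / s) by simp]
  -- This shift moves one centre exactly onto the other, so `ρ = 0`. The postcondition evaluates
  -- `e₁` and `e₂` after the samplings; the freshness conditions give them their initial values.
  refine symLift_sample_lap x y e₁ e₂ (c := e₂.eval m₂ - e₁.eval m₁) hs (by simp) fun v => ?_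
  rw [Var.get_set_self x v m₁, Var.get_set_self y (v + (e₂.eval m₂ - e₁.eval m₁)) m₂]
  simp only [Expr.eval_set_of_notMem _ _ hx, Expr.eval_set_of_notMem _ _ hy]
  ring

end Language

/-! ### Semantics of loops -/

theorem SRel.bind_map_apply {X Y Z : Type} [MeasurableSpace X] [MeasurableSpace Y]
    [MeasurableSpace Z] (g : SRel Y Z) (μ : Measure X) {f : X → Y} (hf : Measurable f) {A : Set Z}
    (hA : MeasurableSet A) : (μ.map f).bind g.1 A = ∫⁻ x, g.1 (f x) A ∂μ := by
  rw [Measure.bind_apply hA g.1.measurable.aemeasurable,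
    lintegral_map (Kernel.measurable_coe g.1 hA) hf]

theorem SRel.bind_map_of_dirac {X Y Z : Type} [MeasurableSpace X] [MeasurableSpace Y]
    [MeasurableSpace Z] (g : SRel Y Z) (μ : Measure X) {f : X → Y} (hf : Measurable f) {k : X → Z}
    (hk : Measurable k) (h : ∀ x, g.1 (f x) = Measure.dirac (k x)) :
    (μ.map f).bind g.1 = μ.map k := by
  ext A hA
  rw [SRel.bind_map_apply g μ hf hA, Measure.map_apply hk hA, ← lintegral_indicator_one (hk hA)]
  refine lintegral_congr fun x => ?_
  rw [h, Measure.dirac_apply' _ hA]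
  rfl

theorem SRel.whileApprox_zero_apply {X : Type} [MeasurableSpace X] (b : X → Bool)
    (hb : Measurable b) (c : SRel X X) {x : X} (h : b x = true) :
    (SRel.whileApprox b hb c 0).1 x = 0 := by
  rw [SRel.whileApprox, SRel.cond_apply, if_pos h]
  rfl

theorem SRel.whileApprox_succ_apply {X : Type} [MeasurableSpace X] (b : X → Bool)
    (hb : Measurable b) (c : SRel X X) (n : ℕ) {x : X} (h : b x = true) :
    (SRel.whileApprox b hb c (n + 1)).1 x = (c.1 x).bind (SRel.whileApprox b hb c n).1 := by
  rw [SRel.whileApprox, SRel.cond_apply, if_pos h, SRel.comp_apply]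

theorem SRel.whileApprox_apply_of_false {X : Type} [MeasurableSpace X] (b : X → Bool)
    (hb : Measurable b) (c : SRel X X) (n : ℕ) {x : X} (h : b x = false) :
    (SRel.whileApprox b hb c n).1 x = Measure.dirac x := by
  cases n <;> rw [SRel.whileApprox, SRel.cond_apply, if_neg (by simp [h])] <;>
    exact SRel.pure_apply _ _ x

theorem SRel.loop_apply {X : Type} [MeasurableSpace X] (b : X → Bool)
    (hb : Measurable b) (c : SRel X X) (x : X) {B : Set X} (hB : MeasurableSet B) :
    (SRel.loop b hb c).1 x B = ⨆ n, (SRel.whileApprox b hb c n).1 x B :=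
  SRel.supMeasure_apply _ (SRel.whileApprox_mono b hb c) x hB

/-! ### The above-threshold algorithm -/

namespace Above

variable {N : ℕ}

/-- The value of `j`. -/
def idx (m : Mem (ctx N)) : ℤ := m .j

/-- The value of `r`. -/
def res (m : Mem (ctx N)) : ℤ := m .r

/-- The value of `T`. -/
def thr (m : Mem (ctx N)) : ℝ := m .T

/-- The value of `d`. -/
def db (m : Mem (ctx N)) : Fin N → ℝ := m .d

theorem measurable_res : Measurable (res (N := N)) := r.measurable_get

/-- The memory after one run of the loop body in which the value `v` is drawn for `S`. -/
noncomputable def step (size : ℕ) (m : Mem (ctx N)) (v : ℝ) : Mem (ctx N)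
  | .j => idx m + 1
  | .r => if thr m ≤ v ∧ res m = size + 1 then idx m else res m
  | .T => m .T
  | .S => v
  | .d => m .d

variable (ε t : ℝ) (Q : ℤ) (size : ℕ) (evalQ : ℤ × ℤ × (Fin N → ℝ) → ℝ)
  (hevalQ : Measurable evalQ)

theorem idx_step (m : Mem (ctx N)) (v : ℝ) : idx (step size m v) = idx m + 1 := rfl

theorem res_step (m : Mem (ctx N)) (v : ℝ) :
    res (step size m v) = if thr m ≤ v ∧ res m = size + 1 then idx m else res m := rfl

theorem measurable_step (m : Mem (ctx N)) : Measurable (step size m) := by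
  refine measurable_pi_lambda _ fun x => ?_
  cases x with
  | j => exact measurable_const
  | r =>
    refine Measurable.ite ?_ measurable_const measurable_const
    exact (measurableSet_Ici (a := thr m)).inter (MeasurableSet.const _)
  | T => exact measurable_const
  | S => exact measurable_id
  | d => exact measurable_const

/-- Once `S` is drawn the rest of the body is deterministic, so the whole body is the pushforward of
a single Laplacian. -/
theorem interp_body (m : Mem (ctx N)) :
    (body ε Q size evalQ hevalQ).interp.1 m =
      ((lap (4 / ε)).1 (evalQ (Q, idx m, db m))).map (step size m) := by
  rw [body, Cmd.interp, SRel.comp_apply, Imp.interp_sample_lap]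
  refine SRel.bind_map_of_dirac _ _ (S.measurable_set_left m) (measurable_step size m) fun v => ?_
  rw [Cmd.interp, Cmd.interp, Cmd.interp, SRel.unit_comp]
  have hite : ∀ m' : Mem (ctx N), (Imp.ite
      ((Expr.leReal (.var T) (.var S)).and
        (Expr.eqInt (.var r) (.add (.const (τ := .int) (size : ℤ)) (.const (τ := .int) (1 : ℤ)))))
      (.seq (.assign r (.var j)) .skip) .skip).interp.1 m' = Measure.dirac
        (if thr m' ≤ m' .S ∧ res m' = size + 1 then Function.update m' .r (m' .j) else m') := by
    intro m'
    rw [Imp.interp, Cmd.interp, Cmd.interp, Cmd.interp, SRel.unit_comp, SRel.cond_apply, Imp.interp,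
      SRel.pure_apply, SRel.unit, SRel.pure_apply, apply_ite Measure.dirac]
    refine if_congr ?_ rfl rfl
    change (decide _ && decide _) = true ↔ _
    rw [Bool.and_eq_true, decide_eq_true_iff, decide_eq_true_iff]
    rfl
  rw [SRel.comp_apply_of_dirac _ _ (hite _), Imp.interp, SRel.pure_apply]
  refine congrArg Measure.dirac ?_
  have hset : S.set (v, m) = Function.update m .S v := rfl
  have hj : ∀ m' : Mem (ctx N), j.set (((Expr.var j).add (.const (τ := .int) (1 : ℤ))).eval m', m') =
      Function.update m' .j (idx m' + 1) := fun _ => rfl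
  have hcond : (thr (Function.update m .S v) ≤ Function.update m .S v .S ∧
      res (Function.update m .S v) = size + 1) ↔ (thr m ≤ v ∧ res m = size + 1) := Iff.rfl
  rw [hj, hset, if_congr hcond rfl rfl]
  by_cases h : thr m ≤ v ∧ res m = size + 1
  · rw [if_pos h]
    funext x
    cases x with
    | r => exact (if_pos h).symm
    | _ => rfl
  · rw [if_neg h]
    funext x
    cases x with
    | r => exact (if_neg h).symm
    | _ => rfl

/-- The approximations of the main loop. -/
noncomputable abbrev approx (n : ℕ) : SRel (Mem (ctx N)) (Mem (ctx N)) :=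
  SRel.whileApprox (Expr.eval (.ltInt (.var j) (.const (τ := .int) (size : ℤ))))
    (Expr.measurable_eval _) (body ε Q size evalQ hevalQ).interp n

variable {size}

-- Outcome probabilities of the finite unfoldings

theorem eval_guard (m : Mem (ctx N)) :
    Expr.eval (.ltInt (.var j) (.const (τ := .int) (size : ℤ))) m = decide (idx m < size) := rfl

theorem measurableSet_res (i : ℤ) : MeasurableSet (res (N := N) ⁻¹' {i}) :=
  measurable_res (measurableSet_singleton i)

theorem approx_of_le (n : ℕ) {m : Mem (ctx N)} (h : (size : ℤ) ≤ idx m) (i : ℤ) :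
    (approx ε Q size evalQ hevalQ n).1 m (res ⁻¹' {i}) = if res m = i then 1 else 0 := by
  rw [approx, SRel.whileApprox_apply_of_false _ _ _ _ (by simpa [eval_guard] using h),
    Measure.dirac_apply' _ (measurableSet_res i)]
  by_cases hi : res m = i <;> simp [hi]

theorem approx_zero {m : Mem (ctx N)} (h : idx m < size) (A : Set (Mem (ctx N))) :
    (approx ε Q size evalQ hevalQ 0).1 m A = 0 := by
  rw [approx, SRel.whileApprox_zero_apply _ _ _ (by simpa [eval_guard] using h)]
  rfl

theorem approx_succ (n : ℕ) {m : Mem (ctx N)} (h : idx m < size) {A : Set (Mem (ctx N))}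
    (hA : MeasurableSet A) :
    (approx ε Q size evalQ hevalQ (n + 1)).1 m A =
      ∫⁻ v, (approx ε Q size evalQ hevalQ n).1 (step size m v) A
        ∂(lap (4 / ε)).1 (evalQ (Q, idx m, db m)) := by
  rw [approx, SRel.whileApprox_succ_apply _ _ _ _ (by simpa [eval_guard] using h), interp_body,
    SRel.bind_map_apply _ _ (measurable_step size m) hA]

theorem measurable_approx_step (n : ℕ) (m : Mem (ctx N)) {A : Set (Mem (ctx N))}
    (hA : MeasurableSet A) :
    Measurable fun v => (approx ε Q size evalQ hevalQ n).1 (step size m v) A :=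
  (Kernel.measurable_coe _ hA).comp (measurable_step size m)

variable {ε}

/-- Once `r` has been overwritten it is never changed again. -/
theorem approx_of_decided (hε : 0 < ε) (i : ℤ) (n : ℕ) {m : Mem (ctx N)} (h : res m ≠ size + 1) :
    (approx ε Q size evalQ hevalQ n).1 m (res ⁻¹' {i}) =
      if res m = i ∧ (size : ℤ) ≤ idx m + n then 1 else 0 := by
  -- The bound `size ≤ idx m + n` says that `n` unfoldings suffice to leave the loop; otherwise all
  -- mass is lost to `null`.
  induction n generalizing m with
  | zero =>
    rcases lt_or_ge (idx m) size with hj | hj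
    · rw [approx_zero ε Q evalQ hevalQ hj, if_neg (by simp [hj])]
    · rw [approx_of_le ε Q evalQ hevalQ 0 hj]
      simp [hj]
  | succ n ih =>
    rcases lt_or_ge (idx m) size with hj | hj
    · have hstep : ∀ v, res (step size m v) = res m := fun v => by
        rw [res_step, if_neg (fun h' => h h'.2)]
      -- The integrand does not depend on the draw, so total mass 1 returns it unchanged.
      have := isProbabilityMeasure_lap (s := 4 / ε) (by positivity) (evalQ (Q, idx m, db m))
      rw [approx_succ ε Q evalQ hevalQ n hj (measurableSet_res i)]
      simp only [ih ((hstep _).trans_ne h), hstep, idx_step, lintegral_const, measure_univ, mul_one]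
      push_cast
      rw [add_assoc, add_comm (1 : ℤ)]
    · rw [approx_of_le ε Q evalQ hevalQ _ hj]
      have : (size : ℤ) ≤ idx m + (n + 1 : ℕ) := by omega
      simp only [this, and_true]

/-- If `r` is still undecided after the round `i`, its final value is not `i`. -/
theorem approx_of_missed (hε : 0 < ε) {i : ℤ} (hi : i ≠ size + 1) (n : ℕ) {m : Mem (ctx N)}
    (h : res m = size + 1) (hj' : i < idx m) :
    (approx ε Q size evalQ hevalQ n).1 m (res ⁻¹' {i}) = 0 := by
  induction n generalizing m with
  | zero =>
    rcases lt_or_ge (idx m) size with hj | hj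
    · rw [approx_zero ε Q evalQ hevalQ hj]
    · rw [approx_of_le ε Q evalQ hevalQ 0 hj, if_neg (by omega)]
  | succ n ih =>
    rcases lt_or_ge (idx m) size with hj | hj
    · rw [approx_succ ε Q evalQ hevalQ n hj (measurableSet_res i)]
      refine (lintegral_congr fun v => ?_).trans lintegral_zero
      -- Either `r` becomes `idx m > i` for good, or it stays undecided and the induction hypothesis
      -- applies.
      by_cases hv : thr m ≤ v
      · have hr : res (step size m v) = idx m := by rw [res_step, if_pos ⟨hv, h⟩]
        rw [approx_of_decided Q evalQ hevalQ hε i n (by omega), if_neg (by omega)]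
      · have hr : res (step size m v) = res m := by rw [res_step, if_neg (fun h' => hv h'.1)]
        exact ih (hr.trans h) (by rw [idx_step]; omega)
    · rw [approx_of_le ε Q evalQ hevalQ _ hj, if_neg (by omega)]

/-- The main loop, run with thresholds `T` and `T + 1`. -/
theorem approx_le_of_thr_add_one (hε : 0 < ε) (i : ℤ) (n : ℕ) {m₁ m₂ : Mem (ctx N)}
    (hq : ∀ k, |evalQ (Q, k, db m₁) - evalQ (Q, k, db m₂)| ≤ 1)
    (hr₁ : res m₁ = size + 1) (hr₂ : res m₂ = size + 1) (hj : idx m₁ = idx m₂)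
    (hT : thr m₁ + 1 = thr m₂) :
    (approx ε Q size evalQ hevalQ n).1 m₁ (res ⁻¹' {i}) ≤
      ENNReal.ofReal (Real.exp (ε / 2)) *
        (approx ε Q size evalQ hevalQ n).1 m₂ (res ⁻¹' {i}) := by
  -- The factor is the budget for round `i`; if the loop ends with `r` undecided it is unspent and
  -- serves as slack.
  have hone : 1 ≤ ENNReal.ofReal (Real.exp (ε / 2)) := by
    rw [ENNReal.one_le_ofReal]
    exact Real.one_le_exp (by positivity)
  have hterm : ∀ {m₁ m₂ : Mem (ctx N)} (n : ℕ), res m₁ = res m₂ → idx m₁ = idx m₂ →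
      (size : ℤ) ≤ idx m₁ → (approx ε Q size evalQ hevalQ n).1 m₁ (res ⁻¹' {i}) ≤
        ENNReal.ofReal (Real.exp (ε / 2)) *
          (approx ε Q size evalQ hevalQ n).1 m₂ (res ⁻¹' {i}) := by
    intro m₁ m₂ n hr hj hge
    rw [approx_of_le ε Q evalQ hevalQ n hge, approx_of_le ε Q evalQ hevalQ n (hj ▸ hge), hr]
    exact le_mul_of_one_le_left' hone
  induction n generalizing m₁ m₂ with
  | zero =>
    rcases lt_or_ge (idx m₁) size with hlt | hge
    · rw [approx_zero ε Q evalQ hevalQ hlt]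
      exact zero_le
    · exact hterm 0 (hr₁.trans hr₂.symm) hj hge
  | succ n ih =>
    rcases lt_or_ge (idx m₁) size with hlt | hge
    swap
    · exact hterm (n + 1) (hr₁.trans hr₂.symm) hj hge
    have hlt₂ : idx m₂ < size := hj ▸ hlt
    rw [approx_succ ε Q evalQ hevalQ n hlt (measurableSet_res i),
      approx_succ ε Q evalQ hevalQ n hlt₂ (measurableSet_res i)]
    have hr_pos : ∀ {m : Mem (ctx N)} {v : ℝ}, res m = size + 1 → thr m ≤ v →
        res (step size m v) = idx m := fun h hv => by rw [res_step, if_pos ⟨hv, h⟩]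
    have hr_neg : ∀ {m : Mem (ctx N)} {v : ℝ}, res m = size + 1 → v < thr m →
        res (step size m v) = size + 1 := fun h hv => by
      rw [res_step, if_neg (fun h' => hv.not_ge h'.1), h]
    have hqj := abs_le.1 (hq (idx m₁))
    rw [← hj]
    by_cases hi : idx m₁ = i
    · have key := lintegral_lap_le_of_shift (s := 4 / ε) (a := evalQ (Q, idx m₁, db m₁))
        (a' := evalQ (Q, idx m₁, db m₂)) (c := 1) (ρ := 2) (by positivity)
        (abs_le.2 ⟨by linarith, by linarith⟩)
        (F := fun v => (approx ε Q size evalQ hevalQ n).1 (step size m₁ v) (res ⁻¹' {i}))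
        (measurable_approx_step (size := size) ε Q evalQ hevalQ n m₂ (measurableSet_res i))
        (C := 1) fun v => by
          rw [one_mul]
          rcases lt_or_ge v (thr m₁) with hv | hv
          · rw [approx_of_missed Q evalQ hevalQ hε (by omega) n (hr_neg hr₁ hv)
              (by rw [idx_step]; omega)]
            exact zero_le
          · have h₁ := hr_pos hr₁ hv
            have h₂ := hr_pos (v := v + 1) hr₂ (by linarith)
            rw [approx_of_decided Q evalQ hevalQ hε i n (by omega),
              approx_of_decided Q evalQ hevalQ hε i n (by omega), h₁, h₂, idx_step, idx_step, hj]
      rwa [one_mul, show (2 : ℝ) / (4 / ε) = ε / 2 by field_simp; norm_num] at key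
    -- Any other round: equal noise, `ρ = 0`, and the budget `C` is handed on to the induction
    -- hypothesis.
    · have key := lintegral_lap_le_of_shift (s := 4 / ε) (a := evalQ (Q, idx m₁, db m₁))
        (a' := evalQ (Q, idx m₁, db m₂)) (ρ := 0)
        (c := evalQ (Q, idx m₁, db m₂) - evalQ (Q, idx m₁, db m₁)) (by positivity) (by simp)
        (F := fun v => (approx ε Q size evalQ hevalQ n).1 (step size m₁ v) (res ⁻¹' {i}))
        (measurable_approx_step (size := size) ε Q evalQ hevalQ n m₂ (measurableSet_res i))
        (C := ENNReal.ofReal (Real.exp (ε / 2))) fun v => by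
          rcases lt_or_ge v (thr m₁) with hv | hv
          · refine ih hq (hr_neg hr₁ hv) (hr_neg hr₂ ?_) ?_ hT
            -- The second sample exceeds the first by at most 1, and its threshold by exactly 1.
            · linarith
            · rw [idx_step, idx_step, hj]
          · have h₁ := hr_pos hr₁ hv
            rw [approx_of_decided Q evalQ hevalQ hε i n (by omega), if_neg (by omega)]
            exact zero_le
      simpa using key

/-- The memory at the start of the main loop, if the value `v` is drawn for `T`. -/
def loopStart (size : ℕ) (m : Mem (ctx N)) (v : ℝ) : Mem (ctx N) :=
  T.set (v, r.set ((size : ℤ) + 1, j.set ((1 : ℤ), m)))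

theorem measurable_loopStart (m : Mem (ctx N)) : Measurable (loopStart size m) :=
  T.measurable_set_left _

-- The whole algorithm: noise on the threshold

variable (size ε)

/-- The main loop. -/
noncomputable abbrev mainLoop : SRel (Mem (ctx N)) (Mem (ctx N)) :=
  SRel.loop (Expr.eval (.ltInt (.var j) (.const (τ := .int) (size : ℤ))))
    (Expr.measurable_eval _) (body ε Q size evalQ hevalQ).interp

theorem interp_aboveT (m : Mem (ctx N)) {A : Set (Mem (ctx N))} (hA : MeasurableSet A) :
    (aboveT ε t Q size evalQ hevalQ).interp.1 m A =
      ∫⁻ v, (mainLoop ε Q size evalQ hevalQ).1 (loopStart size m v) A ∂(lap (2 / ε)).1 t := by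
  rw [aboveT, Cmd.interp, Imp.interp, SRel.comp_apply_of_dirac _ _ (SRel.pure_apply _ _ m),
    Cmd.interp, Imp.interp, SRel.comp_apply_of_dirac _ _ (SRel.pure_apply _ _ _),
    Cmd.interp, SRel.comp_apply, Imp.interp_sample_lap, SRel.bind_map_apply _ _
      (T.measurable_set_left _) hA, Cmd.interp, Cmd.interp, SRel.unit_comp, Imp.interp]
  rfl

variable {size ε}

theorem interp_aboveT_le (hε : 0 < ε) {m₁ m₂ : Mem (ctx N)}
    (hq : ∀ k, |evalQ (Q, k, db m₁) - evalQ (Q, k, db m₂)| ≤ 1) (i : ℤ) :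
    (aboveT ε t Q size evalQ hevalQ).interp.1 m₁ (res ⁻¹' {i}) ≤
      ENNReal.ofReal (Real.exp ε) *
        (aboveT ε t Q size evalQ hevalQ).interp.1 m₂ (res ⁻¹' {i}) := by
  rw [interp_aboveT ε t Q size evalQ hevalQ m₁ (measurableSet_res i),
    interp_aboveT ε t Q size evalQ hevalQ m₂ (measurableSet_res i)]
  -- Both thresholds have centre `t`; raising one by 1 costs `exp (1 / (2 / ε)) = exp (ε / 2)`, the
  -- other half of the budget.
  have key := lintegral_lap_le_of_shift (s := 2 / ε) (a := t) (a' := t) (c := 1) (ρ := 1)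
    (by positivity) (by simp)
    (F := fun v => (mainLoop ε Q size evalQ hevalQ).1 (loopStart size m₁ v) (res ⁻¹' {i}))
    ((Kernel.measurable_coe (mainLoop ε Q size evalQ hevalQ).1 (measurableSet_res i)).comp
      (measurable_loopStart m₂))
    (C := ENNReal.ofReal (Real.exp (ε / 2))) fun v => by
      rw [Function.comp_apply, SRel.loop_apply _ _ _ _ (measurableSet_res i),
        SRel.loop_apply _ _ _ _ (measurableSet_res i), ENNReal.mul_iSup]
      -- Both loops are compared at the same unfolding depth, so the bound survives the suprema.
      exact iSup_mono fun n => approx_le_of_thr_add_one Q evalQ hevalQ hε i n hq rfl rfl rfl rfl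
  rw [← mul_assoc, ← ENNReal.ofReal_mul (Real.exp_pos _).le, ← Real.exp_add,
    show ε / 2 + 1 / (2 / ε) = ε by field_simp; norm_num] at key
  exact key

/-- The reverse half does not invert the shift of `T`: adjacency is symmetric, so the same bound is
applied with the memories exchanged, again raising the threshold of the dominating run. -/
theorem valid_aboveT (hε : 0 < ε)
    (hq : ∀ (i : ℤ) (a b : Fin N → ℝ), ∑ k, |a k - b k| ≤ 1 →
      |evalQ (Q, i, a) - evalQ (Q, i, b)| ≤ 1) :
    Valid (aboveT ε t Q size evalQ hevalQ) (aboveT ε t Q size evalQ hevalQ) (Real.exp ε) 0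
      (fun m₁ m₂ => ∑ k, |d.get m₁ k - d.get m₂ k| ≤ 1) (fun m₁ m₂ => r.get m₁ = r.get m₂) := by
  refine ⟨SRel.measurable_toFun _, SRel.measurable_toFun _, fun m₁ m₂ hm => ?_⟩
  have hq' : ∀ k, |evalQ (Q, k, db m₁) - evalQ (Q, k, db m₂)| ≤ 1 := fun k => hq k _ _ hm
  refine ⟨?_, (lift_congr_rel fun _ _ => eq_comm).1 ?_⟩
  · refine lift_eq_of_forall r.measurable_get r.measurable_get (fun _ => le_rfl) hasSum_zero
      fun i => ?_
    rw [ENNReal.ofReal_zero, add_zero]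
    exact interp_aboveT_le t Q evalQ hevalQ hε hq' i
  · refine lift_eq_of_forall r.measurable_get r.measurable_get (fun _ => le_rfl) hasSum_zero
      fun i => ?_
    rw [ENNReal.ofReal_zero, add_zero]
    exact interp_aboveT_le t Q evalQ hevalQ hε (fun k => (abs_sub_comm _ _).trans_le (hq' k)) i

end Above

end ApRHL

theorem mainTheorem4 :
    (∀ (N : ℕ) (ε t : ℝ) (Q : ℤ) (size : ℕ) (evalQ : ℤ × ℤ × (Fin N → ℝ) → ℝ)
      (hevalQ : Measurable evalQ), 0 < ε →
      (∀ (i : ℤ) (a b : Fin N → ℝ), ∑ k, |a k - b k| ≤ 1 →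
        |evalQ (Q, i, a) - evalQ (Q, i, b)| ≤ 1) →
      ApRHL.Valid (ApRHL.Above.aboveT ε t Q size evalQ hevalQ)
        (ApRHL.Above.aboveT ε t Q size evalQ hevalQ) (Real.exp ε) 0
        (fun m₁ m₂ => ∑ k, |ApRHL.Above.d.get m₁ k - ApRHL.Above.d.get m₂ k| ≤ 1)
        (fun m₁ m₂ => ApRHL.Above.r.get m₁ = ApRHL.Above.r.get m₂)) ∧
    ApRHL.ForallEqOneSidedSound ∧ ApRHL.ForallEqSound ∧
    ApRHL.LapGenSound ∧ ApRHL.LapNullSound := by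
  exact ⟨fun _ _ t Q _ evalQ hevalQ hε hq => ApRHL.Above.valid_aboveT t Q evalQ hevalQ hε hq,
    ApRHL.forallEqOneSidedSound, ApRHL.forallEqSound, ApRHL.lapGenSound, ApRHL.lapNullSound⟩
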